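/- Let $P = -i\,d/dx$ and let $Q$ be multiplication by $x$, as self-adjoint operators in $L^2(\mathbb{R})$. Let $f, g : \mathbb{R} \to \mathbb{R}$ be bounded measurable functions, and let $C = i[f(P), g(Q)] = i\,(f(P)g(Q) - g(Q)f(P))$, a bounded operator on $L^2(\mathbb{R})$. Suppose that $C \ge 0$ (that is, $C$ is positive semidefinite) and $C \ne 0$. Then there are functions $F, G : \mathbb{R} \to \mathbb{R}$ with $F = f$ and $G = g$ Lebesgue-almost everywhere such that $F$ and $G$ are either both non-decreasing or both non-increasing on $\mathbb{R}$. -/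

import Mathlib

open MeasureTheory
open scoped ENNReal

noncomputable section

namespace PosComm

/-- The complex Hilbert space `L²(ℝ)` with respect to Lebesgue measure. -/
abbrev L2 : Type := Lp ℂ 2 (volume : Measure ℝ)

/-- `f : ℝ → ℝ` is (Borel) measurable and bounded. -/
structure BddMeasurable (f : ℝ → ℝ) : Prop where
  measurable : Measurable f
  bounded : ∃ M : ℝ, ∀ x, |f x| ≤ M

theorem BddMeasurable.memLp {f : ℝ → ℝ} (hf : BddMeasurable f) :
    MemLp (fun x => (f x : ℂ)) ∞ (volume : Measure ℝ) := by
  obtain ⟨M, hM⟩ := hf.bounded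
  refine memLp_top_of_bound
    (Complex.measurable_ofReal.comp hf.measurable).aestronglyMeasurable M (.of_forall fun x => ?_)
  simpa using hM x

theorem BddMeasurable.comp_mul {f : ℝ → ℝ} (hf : BddMeasurable f) (c : ℝ) :
    BddMeasurable (fun x => f (c * x)) :=
  ⟨hf.measurable.comp (measurable_const_mul c), hf.bounded.imp fun _ hM x => hM (c * x)⟩

/-- `g(Q)`, where `Q` is multiplication by `x` in `L²(ℝ)`: the bounded operator
`(g(Q) ψ)(x) = g(x) ψ(x)`. -/
def funQ (g : ℝ → ℝ) (hg : BddMeasurable g) : L2 →L[ℂ] L2 :=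
  (ContinuousLinearMap.mul ℂ ℂ).holderL volume ∞ 2 2 (hg.memLp.toLp _)

theorem funQ_apply_ae (g : ℝ → ℝ) (hg : BddMeasurable g) (ψ : L2) :
    funQ g hg ψ =ᵐ[volume] fun x => (g x : ℂ) * ψ x := by
  have h1 := (ContinuousLinearMap.mul ℂ ℂ).coeFn_holder (r := 2) (hg.memLp.toLp _) ψ
  filter_upwards [h1, hg.memLp.coeFn_toLp] with x hx hx'
  change ((ContinuousLinearMap.mul ℂ ℂ).holder 2 (hg.memLp.toLp _) ψ : L2) x = _
  rw [hx, hx']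
  rfl

/-- `f(P)`, where `P = -i d/dx` in `L²(ℝ)`. The unitary Fourier transform `𝓕` of Mathlib is
normalized by `(𝓕 ψ)(ξ) = ∫ exp(-2πi x ξ) ψ(x) dx`, so that `𝓕 P 𝓕⁻¹` is multiplication by `2πξ`
and `f(P) = 𝓕⁻¹ M 𝓕` with `M` the multiplication by `f(2πξ)`. -/
def funP (f : ℝ → ℝ) (hf : BddMeasurable f) : L2 →L[ℂ] L2 :=
  ((Lp.fourierTransformₗᵢ ℝ ℂ).symm.toContinuousLinearEquiv : L2 →L[ℂ] L2) ∘L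
    funQ (fun ξ => f (2 * Real.pi * ξ)) (hf.comp_mul (2 * Real.pi)) ∘L
      ((Lp.fourierTransformₗᵢ ℝ ℂ).toContinuousLinearEquiv : L2 →L[ℂ] L2)

/-- The bounded operator `i [f(P), g(Q)] = i (f(P) g(Q) - g(Q) f(P))`. -/
def comm (f g : ℝ → ℝ) (hf : BddMeasurable f) (hg : BddMeasurable g) : L2 →L[ℂ] L2 :=
  Complex.I • (funP f hf ∘L funQ g hg - funQ g hg ∘L funP f hf)

end PosComm

end

noncomputable section

open Filter Topology
open scoped SchwartzMap FourierTransform ComplexInnerProductSpace ComplexConjugate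

namespace PosComm

/-! Let `B` be a Fourier multiplier with symbol `F`. The quadratic form of `i[B, G(Q)]` at `ψ` is `∫
G v`, where `v = 2 Im (conj ψ · Bψ)` has integral zero. Since `B` commutes with translations,
positivity at all translates of `ψ` says that `Φ(b) = ∫ G(x + b) v(x) dx` is nonnegative for every
`b`.

Average `Φ` against the tent `(1 - |s|/R)₊`. Moving the average onto `G` turns `G` into a second
primitive, whose Taylor expansion at `0` has linear coefficient `halfDiff G R` and a quadratic error
uniform in `R`. As `∫ v = 0`, the tent average tends, along a sequence of `R`, to `c ∫ x v`, where
`c` is a limit point of the bounded quantity `halfDiff G R / R`. If the Fourier transform of `ψ` is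
a real test function `φ`, then `∫ x v = -π⁻¹ ∫ F φ φ'`. Hence `c ∫ F (φ²)' ≤ 0` for all `φ`, and `c
F` is a.e. non-decreasing. If `c = 0`, the tent averages of the nonnegative `Φ` tend to `0`, so `Φ =
0` for every Schwartz `ψ` and the operator vanishes. This is `exists_aeMonotone_of_mulComm_nonneg`.

Conjugation by the Fourier transform (`fourierL2_mulComm`) exchanges the two symbols and gives `d ≠
0` with `d g` a.e. non-decreasing. Here `d` measures the asymmetry of `F`, and `c F` is a.e.
non-decreasing, so `c d ≥ 0` and the two directions agree. -/

/-! ### Tent averages and mean asymmetry of bounded functions -/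

theorem integral_translate_mul_swap {H v : ℝ → ℝ} (hH : Measurable H) {M : ℝ}
    (hM : ∀ x, |H x| ≤ M) (hv : Integrable v) (a b : ℝ) :
    ∫ s in a..b, ∫ x, H (x + s) * v x = ∫ x, (∫ s in a..b, H (x + s)) * v x := by
  rw [intervalIntegral_integral_swap]
  · simp_rw [intervalIntegral.integral_mul_const]
  · have : IsFiniteMeasure (volume.restrict (Set.uIoc a b)) :=
      ⟨by simp [Set.uIoc]⟩
    have h1 : Integrable (fun p : ℝ × ℝ => (1 : ℝ) * v p.2)
        ((volume.restrict (Set.uIoc a b)).prod volume) :=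
      Integrable.mul_prod (f := fun _ : ℝ => (1 : ℝ)) (integrable_const (1 : ℝ)) hv
    refine (h1.bdd_mul (c := M) (f := fun p : ℝ × ℝ => H (p.2 + p.1)) ?_ ?_).congr ?_
    · exact (hH.comp (measurable_snd.add measurable_fst)).aestronglyMeasurable
    · exact .of_forall fun p => by simpa using hM _
    · exact .of_forall fun p => by simp [Function.uncurry]

theorem intervalIntegrable_of_bdd {G : ℝ → ℝ} (hG : Measurable G) {M : ℝ}
    (hM : ∀ x, |G x| ≤ M) (a b : ℝ) : IntervalIntegrable G volume a b :=
  (intervalIntegrable_const (c := M)).mono_fun hG.aestronglyMeasurable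
    (.of_forall fun x => by
      simpa using (hM x).trans (le_abs_self M))

/-- The increment over a window of length `R` of the primitive of `G`. -/
def windowIntegral (G : ℝ → ℝ) (R x : ℝ) : ℝ := ∫ s in x..x + R, G s

theorem abs_windowIntegral_sub_le {G : ℝ → ℝ} (hG : Measurable G) {M : ℝ}
    (hM : ∀ x, |G x| ≤ M) (R x y : ℝ) :
    |windowIntegral G R x - windowIntegral G R y| ≤ 2 * M * |x - y| := by
  have hi := intervalIntegrable_of_bdd hG hM
  have h1 : windowIntegral G R x - windowIntegral G R y
      = (∫ s in y + R..x + R, G s) - ∫ s in y..x, G s := by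
    unfold windowIntegral
    rw [← intervalIntegral.integral_add_adjacent_intervals (hi x y) (hi y (x + R)),
      ← intervalIntegral.integral_add_adjacent_intervals (hi y (y + R)) (hi (y + R) (x + R)),
      intervalIntegral.integral_symm x y]
    ring
  have h2 : |∫ s in y + R..x + R, G s| ≤ M * |x - y| := by
    have := intervalIntegral.norm_integral_le_of_norm_le_const (f := G) (a := y + R) (b := x + R)
      (C := M) (fun z _ => hM z)
    simpa using this
  have h3 : |∫ s in y..x, G s| ≤ M * |x - y| := by
    simpa using intervalIntegral.norm_integral_le_of_norm_le_const (f := G) (a := y) (b := x)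
      (C := M) (fun z _ => hM z)
  rw [h1]
  calc _ ≤ |∫ s in y + R..x + R, G s| + |∫ s in y..x, G s| := abs_sub _ _
    _ ≤ _ := by linarith

theorem continuous_windowIntegral {G : ℝ → ℝ} (hG : Measurable G) {M : ℝ}
    (hM : ∀ x, |G x| ≤ M) (R : ℝ) : Continuous (windowIntegral G R) := by
  have hM0 : 0 ≤ M := (abs_nonneg _).trans (hM 0)
  refine (LipschitzWith.of_dist_le_mul (K := (2 * M).toNNReal) fun x y => ?_).continuous
  rw [Real.dist_eq, Real.dist_eq, Real.coe_toNNReal _ (by positivity)]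
  exact abs_windowIntegral_sub_le hG hM R x y

theorem abs_windowIntegral_le {G : ℝ → ℝ} {M : ℝ} (hM : ∀ x, |G x| ≤ M) (R x : ℝ) :
    |windowIntegral G R x| ≤ M * |R| := by
  simpa [windowIntegral] using intervalIntegral.norm_integral_le_of_norm_le_const
    (f := G) (a := x) (b := x + R) (C := M) (fun z _ => hM z)

/-- `R` times the difference of the mean values of `G` over `[0, R]` and over `[-R, 0]`. -/
def halfDiff (G : ℝ → ℝ) (R : ℝ) : ℝ := windowIntegral G R 0 - windowIntegral G R (-R)

/-- First-order Taylor expansion at `0` of a function whose derivative `H y - H (y - R)` is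
`4M`-Lipschitz and equals `halfDiff G R` at `0`. `G` is only measurable, so the mean value
inequality replaces a second derivative. The error does not depend on `R`. -/
theorem abs_window_taylor_le {G : ℝ → ℝ} (hG : Measurable G) {M : ℝ}
    (hM : ∀ x, |G x| ≤ M) (R x : ℝ) :
    |(∫ u in -R..0, windowIntegral G R (x + u)) - (∫ u in -R..0, windowIntegral G R u)
      - x * halfDiff G R| ≤ 4 * M * x ^ 2 := by
  set H := windowIntegral G R with hH
  have hc : Continuous H := continuous_windowIntegral hG hM R
  have hL : ∀ x y, |H x - H y| ≤ 2 * M * |x - y| := abs_windowIntegral_sub_le hG hM R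
  have hM0 : 0 ≤ M := (abs_nonneg _).trans (hM 0)
  let E : ℝ → ℝ := fun x => (∫ u in -R..0, H (x + u)) - x * halfDiff G R
  have hE : ∀ y, HasDerivAt E (H y - H (y - R) - halfDiff G R) y := by
    intro y
    have e : E = fun x => (∫ u in (0 : ℝ)..x, H u) - (∫ u in (0 : ℝ)..x - R, H u)
        - x * halfDiff G R := by
      funext x
      simp only [E, intervalIntegral.integral_comp_add_left (f := H)]
      rw [← intervalIntegral.integral_add_adjacent_intervals (b := 0)
        (hc.intervalIntegrable _ _) (hc.intervalIntegrable _ _),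
        intervalIntegral.integral_symm 0, add_zero, ← sub_eq_add_neg x R]
      ring
    rw [e]
    have h1 : HasDerivAt (fun x => ∫ u in (0 : ℝ)..x, H u) (H y) y :=
      intervalIntegral.integral_hasDerivAt_right (hc.intervalIntegrable _ _)
        hc.stronglyMeasurable.stronglyMeasurableAtFilter hc.continuousAt
    have h2 : HasDerivAt (fun x => ∫ u in (0 : ℝ)..x, H u) (H (y - R)) (y - R) :=
      intervalIntegral.integral_hasDerivAt_right (hc.intervalIntegrable _ _)
        hc.stronglyMeasurable.stronglyMeasurableAtFilter hc.continuousAt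
    have h3 := h2.comp_sub_const y R
    have h4 := (h1.sub h3).sub ((hasDerivAt_id y).mul_const (halfDiff G R))
    rw [one_mul] at h4
    exact h4
  have hb : ∀ y ∈ Set.uIcc 0 x, ‖H y - H (y - R) - halfDiff G R‖ ≤ 4 * M * |x| := by
    intro y hy
    have hy' : |y| ≤ |x| := by
      have := Set.abs_sub_left_of_mem_uIcc hy
      simpa using this
    have a1 := hL y 0
    have a2 := hL (y - R) (-R)
    simp only [sub_zero, sub_neg_eq_add, sub_add_cancel] at a1 a2
    have : H y - H (y - R) - halfDiff G R = (H y - H 0) - (H (y - R) - H (-R)) := by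
      simp only [halfDiff, ← hH]; ring
    rw [this, Real.norm_eq_abs]
    calc _ ≤ |H y - H 0| + |H (y - R) - H (-R)| := abs_sub _ _
      _ ≤ 2 * M * |y| + 2 * M * |y| := add_le_add a1 a2
      _ = 4 * M * |y| := by ring
      _ ≤ _ := by gcongr
  have := (convex_uIcc (0 : ℝ) x).norm_image_sub_le_of_norm_hasDerivWithin_le
    (fun y _ => (hE y).hasDerivWithinAt) hb Set.left_mem_uIcc Set.right_mem_uIcc
  simp only [E, Real.norm_eq_abs, zero_add, zero_mul, sub_zero] at this
  calc _ = _ := by congr 1; ring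
    _ ≤ _ := this
    _ = _ := by rw [mul_assoc, abs_mul_abs_self]; ring

/-- By Fubini the average moves from the correlation onto `G`. In the Taylor expansion the constant
term is killed by `∫ v = 0`, the linear term gives the first moment, and the second moment controls
the error uniformly in `R`. The iterated integral is the integral against the tent `(R - |s|)₊`. -/
theorem abs_tent_average_sub_le {G v : ℝ → ℝ} (hG : Measurable G) {M : ℝ}
    (hM : ∀ x, |G x| ≤ M) (hv : Integrable v) (hv1 : Integrable fun x => x * v x)
    (hv2 : Integrable fun x => x ^ 2 * v x) (h0 : ∫ x, v x = 0) (R : ℝ) :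
    |(∫ u in -R..0, windowIntegral (fun s => ∫ x, G (x + s) * v x) R u)
      - halfDiff G R * ∫ x, x * v x| ≤ 4 * M * ∫ x, x ^ 2 * |v x| := by
  set H := windowIntegral G R with hH
  have hc : Continuous H := continuous_windowIntegral hG hM R
  have e1 : ∀ u, windowIntegral (fun s => ∫ x, G (x + s) * v x) R u = ∫ x, H (x + u) * v x := by
    intro u
    rw [windowIntegral, integral_translate_mul_swap hG hM hv]
    simp only [intervalIntegral.integral_comp_add_left (f := G), hH, windowIntegral, add_assoc]
  simp_rw [e1]
  rw [integral_translate_mul_swap hc.measurable (abs_windowIntegral_le hM R) hv]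
  set D : ℝ → ℝ := fun x => ∫ u in -R..0, H (x + u)
  set D0 := ∫ u in -R..0, H u
  have hr : ∀ x, |D x - D0 - x * halfDiff G R| ≤ 4 * M * x ^ 2 := abs_window_taylor_le hG hM R
  have hDb : ∀ x, ‖D x‖ ≤ M * |R| * |0 - -R| := fun x =>
    intervalIntegral.norm_integral_le_of_norm_le_const fun z _ => abs_windowIntegral_le hM R _
  have hDc : Continuous D :=
    intervalIntegral.continuous_parametric_intervalIntegral_of_continuous'
      (by fun_prop) _ _
  have hDv : Integrable fun x => D x * v x :=
    hv.bdd_mul hDc.aestronglyMeasurable (.of_forall hDb)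
  have e2 : (∫ x, D x * v x) - halfDiff G R * ∫ x, x * v x
      = ∫ x, (D x - D0 - x * halfDiff G R) * v x := by
    have : ∀ x, (D x - D0 - x * halfDiff G R) * v x
        = (D x * v x - D0 * v x) - halfDiff G R * (x * v x) := fun x => by ring
    simp_rw [this]
    have hDv' : Integrable fun x => D x * v x - D0 * v x := hDv.sub (hv.const_mul _)
    rw [integral_sub hDv' (hv1.const_mul _),
      integral_sub hDv (hv.const_mul _), integral_const_mul, integral_const_mul, h0]
    ring
  rw [e2, ← integral_const_mul]
  have habs : Integrable fun x => 4 * M * (x ^ 2 * |v x|) := by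
    refine (hv2.abs.congr (.of_forall fun x => ?_)).const_mul _
    simp [abs_mul]
  refine (norm_integral_le_integral_norm (μ := volume)
    (fun x => (D x - D0 - x * halfDiff G R) * v x)).trans ?_
  refine integral_mono_of_nonneg (.of_forall fun x => norm_nonneg _) habs (.of_forall fun x => ?_)
  dsimp only
  rw [norm_mul, Real.norm_eq_abs, Real.norm_eq_abs, ← mul_assoc]
  gcongr
  exact hr x

theorem tendsto_tent_average {G v : ℝ → ℝ} (hG : Measurable G) {M : ℝ}
    (hM : ∀ x, |G x| ≤ M) (hv : Integrable v) (hv1 : Integrable fun x => x * v x)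
    (hv2 : Integrable fun x => x ^ 2 * v x) (h0 : ∫ x, v x = 0) {R : ℕ → ℝ}
    (hR : Tendsto R atTop atTop) {c : ℝ}
    (hc : Tendsto (fun n => (R n)⁻¹ * halfDiff G (R n)) atTop (𝓝 c)) :
    Tendsto (fun n => (R n)⁻¹ *
        ∫ u in -R n..0, windowIntegral (fun s => ∫ x, G (x + s) * v x) (R n) u)
      atTop (𝓝 (c * ∫ x, x * v x)) := by
  have hz : Tendsto (fun n => (R n)⁻¹ * (4 * M * ∫ x, x ^ 2 * |v x|)) atTop (𝓝 0) := by
    simpa using (tendsto_inv_atTop_zero.comp hR).mul_const (4 * M * ∫ x, x ^ 2 * |v x|)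
  have h1 := squeeze_zero_norm' (f := fun n => (R n)⁻¹ *
        ((∫ u in -R n..0, windowIntegral (fun s => ∫ x, G (x + s) * v x) (R n) u)
        - halfDiff G (R n) * ∫ x, x * v x)) (by
      filter_upwards [hR.eventually_gt_atTop 0] with n hn
      rw [norm_mul, Real.norm_eq_abs, Real.norm_eq_abs, abs_of_pos (inv_pos.2 hn)]
      gcongr
      exact abs_tent_average_sub_le hG hM hv hv1 hv2 h0 _) hz
  have h2 := h1.add (hc.mul_const (∫ x, x * v x))
  rw [zero_add] at h2
  exact h2.congr fun n => by ring

theorem windowIntegral_nonneg {Φ : ℝ → ℝ} (hΦ : ∀ x, 0 ≤ Φ x) {R : ℝ} (hR : 0 ≤ R) (x : ℝ) :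
    0 ≤ windowIntegral Φ R x :=
  intervalIntegral.integral_nonneg (by linarith) fun _ _ => hΦ _

theorem tent_average_nonneg {Φ : ℝ → ℝ} (hΦ : ∀ x, 0 ≤ Φ x) {R : ℝ} (hR : 0 ≤ R) :
    0 ≤ ∫ u in -R..0, windowIntegral Φ R u :=
  intervalIntegral.integral_nonneg (by linarith) fun _ _ => windowIntegral_nonneg hΦ hR _

/-- The tents `(1 - |s|/R)₊` increase to `1`, so the averages eventually nearly dominate the
integral of `Φ` over `[-1, 1]`, which is positive if `Φ 0 > 0`. -/
theorem eq_zero_of_tent_average_tendsto_zero {Φ : ℝ → ℝ} (hc : Continuous Φ)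
    (hΦ : ∀ x, 0 ≤ Φ x) {R : ℕ → ℝ} (hR : Tendsto R atTop atTop)
    (h : Tendsto (fun n => (R n)⁻¹ * ∫ u in -R n..0, windowIntegral Φ (R n) u) atTop (𝓝 0)) :
    Φ 0 = 0 := by
  by_contra hne
  have hpos : 0 < Φ 0 := lt_of_le_of_ne (hΦ 0) (Ne.symm hne)
  set a := ∫ s in (-1 : ℝ)..1, Φ s
  have ha : 0 < a := intervalIntegral.integral_pos (by norm_num) hc.continuousOn
    (fun _ _ => hΦ _) ⟨0, by constructor <;> norm_num, hpos⟩
  have hlow : ∀ᶠ n in atTop, (1 - 2 * (R n)⁻¹) * a ≤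
      (R n)⁻¹ * ∫ u in -R n..0, windowIntegral Φ (R n) u := by
    filter_upwards [hR.eventually_ge_atTop 2] with n hn
    set r := R n
    have hJc : Continuous (windowIntegral Φ r) := by
      have : windowIntegral Φ r = fun x => ∫ s in (0 : ℝ)..r, Φ (x + s) := by
        funext x
        rw [intervalIntegral.integral_comp_add_left, add_zero, windowIntegral]
      rw [this]
      exact intervalIntegral.continuous_parametric_intervalIntegral_of_continuous'
        (by fun_prop) _ _
    -- For `u` in this interval, of length `r - 2`, the window `[u, u + r]` contains `[-1, 1]`.
    have h1 : (r - 2) * a ≤ ∫ u in -(r - 1)..(-1), windowIntegral Φ r u := by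
      have : ∫ u in -(r - 1)..(-1), a = (r - 2) * a := by simp; ring_nf; left; trivial
      rw [← this]
      refine intervalIntegral.integral_mono_on (by linarith) (by simp)
        (hJc.intervalIntegrable _ _) fun u hu => ?_
      refine intervalIntegral.integral_mono_interval (by linarith [hu.2]) (by norm_num)
        (by linarith [hu.1]) (.of_forall hΦ) (hc.intervalIntegrable _ _)
    have h2 : ∫ u in -(r - 1)..(-1), windowIntegral Φ r u ≤ ∫ u in -r..0, windowIntegral Φ r u :=
      intervalIntegral.integral_mono_interval (by linarith) (by linarith) (by norm_num)
        (.of_forall fun u => windowIntegral_nonneg hΦ (by linarith) u)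
        (hJc.intervalIntegrable _ _)
    have hr : (0 : ℝ) < r := by linarith
    calc (1 - 2 * r⁻¹) * a = r⁻¹ * ((r - 2) * a) := by field_simp
      _ ≤ _ := by gcongr; exact h1.trans h2
  have hl : Tendsto (fun n => (1 - 2 * (R n)⁻¹) * a) atTop (𝓝 a) := by
    simpa using ((tendsto_const_nhds (x := (1 : ℝ))).sub
      ((tendsto_inv_atTop_zero.comp hR).const_mul 2)).mul_const a
  exact absurd (le_of_tendsto_of_tendsto hl h hlow) (not_le.2 ha)

/-- The limit points of the mean asymmetry `R⁻¹ (∫_0^R G - ∫_{-R}^0 G)` exist. -/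
theorem exists_tendsto_halfDiff {G : ℝ → ℝ} {M : ℝ} (hM : ∀ x, |G x| ≤ M) :
    ∃ (R : ℕ → ℝ) (c : ℝ), Tendsto R atTop atTop ∧
      Tendsto (fun n => (R n)⁻¹ * halfDiff G (R n)) atTop (𝓝 c) := by
  have hb : ∀ n : ℕ, (((n : ℝ) + 1)⁻¹ * halfDiff G (n + 1)) ∈ Set.Icc (-(2 * M)) (2 * M) := by
    intro n
    rw [Set.mem_Icc, ← abs_le, abs_mul, abs_of_pos (by positivity : 0 < ((n : ℝ) + 1)⁻¹),
      inv_mul_le_iff₀ (by positivity)]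
    have h1 := abs_windowIntegral_le hM ((n : ℝ) + 1) 0
    have h2 := abs_windowIntegral_le hM ((n : ℝ) + 1) (-((n : ℝ) + 1))
    rw [abs_of_pos (by positivity : 0 < (n : ℝ) + 1)] at h1 h2
    refine (abs_sub _ _).trans ?_
    linarith
  obtain ⟨c, -, φ, hφ, hc⟩ := isCompact_Icc.tendsto_subseq hb
  refine ⟨fun n => (φ n : ℝ) + 1, c, ?_, hc⟩
  exact tendsto_atTop_add_const_right _ _
    (tendsto_natCast_atTop_atTop.comp hφ.tendsto_atTop)

/-- `G 0` separates the means over the two half-windows. This ties the sign of a limit point `c` to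
the direction of monotonicity. -/
theorem halfDiff_nonneg {G : ℝ → ℝ} (hG : Monotone G) {R : ℝ} (hR : 0 ≤ R) :
    0 ≤ halfDiff G R := by
  have h1 : R * G 0 ≤ windowIntegral G R 0 := by
    have : ∫ _ in (0 : ℝ)..0 + R, G 0 = R * G 0 := by simp
    rw [← this]
    exact intervalIntegral.integral_mono_on (by linarith) (by simp)
      hG.intervalIntegrable fun u hu => hG hu.1
  have h2 : windowIntegral G R (-R) ≤ R * G 0 := by
    have : ∫ _ in -R..-R + R, G 0 = R * G 0 := by simp
    rw [← this]
    exact intervalIntegral.integral_mono_on (by linarith)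
      hG.intervalIntegrable (by simp) fun u hu => hG (by simpa using hu.2)
  unfold halfDiff
  linarith

theorem halfDiff_congr_ae {G H : ℝ → ℝ} (h : G =ᵐ[volume] H) (R : ℝ) :
    halfDiff G R = halfDiff H R := by
  unfold halfDiff windowIntegral
  congr 1 <;> exact intervalIntegral.integral_congr_ae (h.mono fun x hx _ => hx)

theorem halfDiff_const_mul (a : ℝ) (G : ℝ → ℝ) (R : ℝ) :
    halfDiff (fun x => a * G x) R = a * halfDiff G R := by
  simp [halfDiff, windowIntegral, intervalIntegral.integral_const_mul, mul_sub]

/-! ### Monotonicity from a nonnegative distributional derivative -/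

/-- `f` agrees almost everywhere with a non-decreasing function. -/
def AEMonotone (f : ℝ → ℝ) : Prop := ∃ F : ℝ → ℝ, Monotone F ∧ F =ᵐ[volume] f

open scoped Convolution in
theorem monotone_convolution {F η : ℝ → ℝ} (hF : LocallyIntegrable F)
    (hη : ContDiff ℝ 1 η) (hs : HasCompactSupport η)
    (h : ∀ y, 0 ≤ ∫ x, F x * deriv η (y - x)) :
    Monotone fun y => ∫ x, F x * η (y - x) := by
  have hd : ∀ y, HasDerivAt (F ⋆[ContinuousLinearMap.mul ℝ ℝ, volume] η)
      ((F ⋆[ContinuousLinearMap.mul ℝ ℝ, volume] deriv η) y) y := fun y =>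
    hs.hasDerivAt_convolution_right (ContinuousLinearMap.mul ℝ ℝ) hF hη y
  refine monotone_of_deriv_nonneg (f := F ⋆[ContinuousLinearMap.mul ℝ ℝ, volume] η)
    (fun y => (hd y).differentiableAt) fun y => ?_
  rw [(hd y).deriv]
  exact h y

theorem monotoneOn_aeMonotone {F : ℝ → ℝ} {M : ℝ} (hM : ∀ x, |F x| ≤ M) {S : Set ℝ}
    (hS : ∀ᵐ x, x ∈ S) (h : MonotoneOn F S) : AEMonotone F := by
  obtain ⟨G, hG, hGS⟩ := h.exists_monotone_extension
    ⟨-M, by rintro _ ⟨x, -, rfl⟩; exact (abs_le.1 (hM x)).1⟩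
    ⟨M, by rintro _ ⟨x, -, rfl⟩; exact (abs_le.1 (hM x)).2⟩
  exact ⟨G, hG, hS.mono fun x hx => (hGS hx).symm⟩

/-- A sequence of bumps centered at `0` shrinking to the origin. -/
def shrinkingBump (n : ℕ) : ContDiffBump (0 : ℝ) :=
  ⟨1 / (n + 1), 2 / (n + 1), by positivity, by gcongr; norm_num⟩

theorem integral_sq_bump_ge (φ : ContDiffBump (0 : ℝ)) : 2 * φ.rIn ≤ ∫ x, φ x ^ 2 := by
  have hi : Integrable fun x => φ x ^ 2 :=
    (φ.continuous.pow 2).integrable_of_hasCompactSupport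
      (by simpa [pow_two] using φ.hasCompactSupport.mul_left (f' := φ))
  have h1 : ∫ x in Metric.closedBall (0 : ℝ) φ.rIn, φ x ^ 2 = 2 * φ.rIn := by
    rw [setIntegral_congr_fun (g := fun _ => (1 : ℝ)) Metric.isClosed_closedBall.measurableSet
      fun x hx => by simp [φ.one_of_mem_closedBall hx]]
    simp [Real.volume_real_closedBall φ.rIn_pos.le]
  rw [← h1]
  exact setIntegral_le_integral hi (.of_forall fun x => sq_nonneg _)

/-- Lebesgue differentiation for an approximate identity made of squares, since the available test
functions are `φ φ' = (φ²)' / 2`. -/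
theorem ae_tendsto_integral_sq_bump {F : ℝ → ℝ} (hF : LocallyIntegrable F) :
    ∀ᵐ y, Tendsto (fun n => ∫ x, F x *
      (shrinkingBump n (y - x) ^ 2 / ∫ z, shrinkingBump n z ^ 2)) atTop (𝓝 (F y)) := by
  filter_upwards [(Besicovitch.vitaliFamily (volume : Measure ℝ)).ae_tendsto_average_norm_sub hF]
    with y h₀
  have hI : ∀ n, 0 < ∫ z, shrinkingBump n z ^ 2 := fun n =>
    (mul_pos two_pos (shrinkingBump n).rIn_pos).trans_le (integral_sq_bump_ge _)
  have hφ0 : Tendsto (fun n : ℕ => (shrinkingBump n).rOut) atTop (𝓝 0) := by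
    have := (tendsto_one_div_add_atTop_nhds_zero_nat (𝕜 := ℝ)).const_mul 2
    simpa [shrinkingBump, div_eq_mul_inv] using this
  have hφ' : Tendsto (fun n => (shrinkingBump n).rOut) atTop (𝓝[>] 0) :=
    tendsto_nhdsWithin_iff.2 ⟨hφ0, Eventually.of_forall fun i => (shrinkingBump i).rOut_pos⟩
  have := (h₀.comp (Besicovitch.tendsto_filterAt volume y)).comp hφ'
  simp_rw [mul_comm (F _)]
  -- The constant `2`: the kernel is at most `1 / (2 rIn)`, and the ball has volume `2 rOut = 4
  -- rIn`.
  refine tendsto_integral_smul_of_tendsto_average_norm_sub (μ := volume)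
    (a := fun n => Metric.closedBall y (shrinkingBump n).rOut)
    (g := fun n x => shrinkingBump n (y - x) ^ 2 / ∫ z, shrinkingBump n z ^ 2) 2 this ?_ ?_ ?_ ?_
  · exact .of_forall fun i => hF.integrableOn_isCompact (isCompact_closedBall _ _)
  · refine tendsto_const_nhds.congr fun n => ?_
    rw [integral_div, integral_sub_left_eq_self (fun x => shrinkingBump n x ^ 2) volume y,
      div_self (hI n).ne']
  · refine .of_forall fun n x hx => ?_
    by_contra hx'
    apply hx
    have : shrinkingBump n (y - x) = 0 := (shrinkingBump n).zero_of_le_dist (by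
      rw [Metric.mem_closedBall, not_le, dist_comm, Real.dist_eq] at hx'
      rw [Real.dist_eq, sub_zero]; exact hx'.le)
    simp [this]
  · refine .of_forall fun n x => ?_
    rw [Real.volume_real_closedBall (shrinkingBump n).rOut_pos.le,
      abs_of_nonneg (div_nonneg (sq_nonneg _) (hI n).le)]
    have h1 : shrinkingBump n (y - x) ^ 2 ≤ 1 :=
      pow_le_one₀ (shrinkingBump n).nonneg (shrinkingBump n).le_one
    have h2 := integral_sq_bump_ge (shrinkingBump n)
    have h3 : (shrinkingBump n).rOut = 2 * (shrinkingBump n).rIn := by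
      simp [shrinkingBump]; ring
    have h4 := (shrinkingBump n).rIn_pos
    rw [h3, div_le_div_iff₀ (hI n) (by positivity)]
    nlinarith

/-- A bounded function whose distributional derivative is nonnegative on squares of smooth
compactly supported functions is almost everywhere equal to a non-decreasing function. -/
theorem aeMonotone_of_integral_nonpos {F : ℝ → ℝ} (hF : Measurable F) {M : ℝ}
    (hM : ∀ x, |F x| ≤ M)
    (h : ∀ φ : ℝ → ℝ, ContDiff ℝ (⊤ : ℕ∞) φ → HasCompactSupport φ →
      ∫ x, F x * (φ x * deriv φ x) ≤ 0) : AEMonotone F := by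
  have hloc : LocallyIntegrable F :=
    (locallyIntegrable_const M).mono hF.aestronglyMeasurable
      (.of_forall fun x => by simpa using (hM x).trans (le_abs_self M))
  have hmono : ∀ n, Monotone fun y => ∫ x, F x *
      (shrinkingBump n (y - x) ^ 2 / ∫ z, shrinkingBump n z ^ 2) := by
    intro n
    set φ := shrinkingBump n
    set I := ∫ z, φ z ^ 2
    have hI : 0 ≤ I := integral_nonneg fun _ => sq_nonneg _
    have hφd : ∀ x, HasDerivAt φ (deriv φ x) x := fun x =>
      ((φ.contDiff (n := 1)).differentiable (by norm_num) x).hasDerivAt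
    refine monotone_convolution (η := fun x => φ x ^ 2 / I) hloc
      ((φ.contDiff.pow 2).div_const _) ?_ fun y => ?_
    · exact φ.hasCompactSupport.comp_left (g := fun t => t ^ 2 / I) (by simp)
    · let χ : ℝ → ℝ := fun x => φ (y - x)
      have hχd : ∀ x, deriv χ x = - deriv φ (y - x) := fun x =>
        ((hφd (y - x)).comp_const_sub y x).deriv
      have hχ := h χ (φ.contDiff.comp (contDiff_const.sub contDiff_id))
        (φ.hasCompactSupport.comp_homeomorph (Homeomorph.subLeft y))
      have e : ∀ x, F x * deriv (fun x => φ x ^ 2 / I) (y - x)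
          = (-(2 / I)) * (F x * (χ x * deriv χ x)) := by
        intro x
        have : deriv (fun x => φ x ^ 2 / I) (y - x) = 2 * φ (y - x) * deriv φ (y - x) / I := by
          simpa using (((hφd (y - x)).pow 2).div_const I).deriv
        rw [this, hχd]
        ring
      simp_rw [e]
      rw [integral_const_mul]
      have : 0 ≤ 2 / I := by positivity
      nlinarith
  -- Limits of monotone functions are monotone on the full-measure set where the mollifications
  -- converge.
  refine monotoneOn_aeMonotone hM (ae_tendsto_integral_sq_bump hloc) fun x hx y hy hxy => ?_
  exact le_of_tendsto_of_tendsto' hx hy fun n => hmono n hxy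

/-! ### Fourier multipliers and the quadratic form of the commutator -/

/-- The Fourier transform as a unitary operator of `L²(ℝ)`. -/
abbrev fourierL2 : L2 ≃ₗᵢ[ℂ] L2 := Lp.fourierTransformₗᵢ ℝ ℂ

/-- The Fourier multiplier with symbol `F`. -/
def fourierMul (F : ℝ → ℝ) (hF : BddMeasurable F) : L2 →L[ℂ] L2 :=
  (fourierL2.symm.toContinuousLinearEquiv : L2 →L[ℂ] L2) ∘L funQ F hF ∘L
    (fourierL2.toContinuousLinearEquiv : L2 →L[ℂ] L2)

theorem fourierMul_apply (F : ℝ → ℝ) (hF : BddMeasurable F) (ψ : L2) :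
    fourierMul F hF ψ = fourierL2.symm (funQ F hF (fourierL2 ψ)) := rfl

/-- The operator `i [B, G(Q)]`, where `B` is the Fourier multiplier with symbol `F`. -/
def mulComm (F G : ℝ → ℝ) (hF : BddMeasurable F) (hG : BddMeasurable G) : L2 →L[ℂ] L2 :=
  Complex.I • (fourierMul F hF ∘L funQ G hG - funQ G hG ∘L fourierMul F hF)

theorem comm_eq_mulComm (f g : ℝ → ℝ) (hf : BddMeasurable f) (hg : BddMeasurable g) :
    comm f g hf hg = mulComm (fun x => f (2 * Real.pi * x)) g (hf.comp_mul _) hg := rfl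

theorem mulComm_apply (F G : ℝ → ℝ) (hF : BddMeasurable F) (hG : BddMeasurable G) (ψ : L2) :
    mulComm F G hF hG ψ =
      Complex.I • (fourierMul F hF (funQ G hG ψ) - funQ G hG (fourierMul F hF ψ)) := rfl

/-- The class in `L²(ℝ)` of a Schwartz function. -/
def toL2 (ψ : 𝓢(ℝ, ℂ)) : L2 := ψ.toLp 2

theorem toL2_ae (ψ : 𝓢(ℝ, ℂ)) : toL2 ψ =ᵐ[volume] ψ := ψ.coeFn_toLp 2 volume

theorem inner_eq_integral (χ ψ : L2) : ⟪χ, ψ⟫ = ∫ x, conj (χ x) * ψ x := by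
  rw [L2.inner_def]
  simp [mul_comm]

theorem integrable_conj_mul (χ ψ : L2) : Integrable fun x => conj (χ x) * ψ x := by
  refine (L2.integrable_inner (𝕜 := ℂ) χ ψ).congr (.of_forall fun x => ?_)
  simp [mul_comm]

theorem integrable_im_conj_mul (χ ψ : L2) : Integrable fun x => 2 * (conj (χ x) * ψ x).im :=
  (integrable_conj_mul χ ψ).im.const_mul 2

theorem integral_im_conj_mul (χ ψ : L2) :
    ∫ x, 2 * (conj (χ x) * ψ x).im = 2 * (⟪χ, ψ⟫).im := by
  rw [integral_const_mul, inner_eq_integral]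
  congr 1
  exact integral_im (𝕜 := ℂ) (integrable_conj_mul χ ψ)

theorem inner_funQ_right (G : ℝ → ℝ) (hG : BddMeasurable G) (χ ψ : L2) :
    ⟪χ, funQ G hG ψ⟫ = ∫ x, (G x : ℂ) * (conj (χ x) * ψ x) := by
  rw [inner_eq_integral]
  refine integral_congr_ae ?_
  filter_upwards [funQ_apply_ae G hG ψ] with x hx
  rw [hx]
  ring

theorem inner_funQ_left (G : ℝ → ℝ) (hG : BddMeasurable G) (χ ψ : L2) :
    ⟪funQ G hG χ, ψ⟫ = ⟪χ, funQ G hG ψ⟫ := by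
  rw [inner_funQ_right, inner_eq_integral]
  refine integral_congr_ae ?_
  filter_upwards [funQ_apply_ae G hG χ] with x hx
  rw [hx, map_mul, Complex.conj_ofReal]
  ring

theorem inner_fourierMul_right (F : ℝ → ℝ) (hF : BddMeasurable F) (χ ψ : L2) :
    ⟪χ, fourierMul F hF ψ⟫ = ⟪fourierL2 χ, funQ F hF (fourierL2 ψ)⟫ := by
  rw [fourierMul_apply, ← fourierL2.inner_map_map, fourierL2.apply_symm_apply]

theorem inner_fourierMul_left (F : ℝ → ℝ) (hF : BddMeasurable F) (χ ψ : L2) :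
    ⟪fourierMul F hF χ, ψ⟫ = ⟪χ, fourierMul F hF ψ⟫ := by
  rw [inner_fourierMul_right, ← inner_funQ_left, fourierMul_apply, ← fourierL2.inner_map_map,
    fourierL2.apply_symm_apply]

/-- `2 Im (conj ψ · B ψ)`, where `B` is the Fourier multiplier with symbol `F`: the quadratic form
of `i [B, G(Q)]` at `ψ` is the integral of `G` against this function. -/
def current (F : ℝ → ℝ) (hF : BddMeasurable F) (ψ : L2) (x : ℝ) : ℝ :=
  2 * (conj (ψ x) * fourierMul F hF ψ x).im

theorem integrable_current (F : ℝ → ℝ) (hF : BddMeasurable F) (ψ : L2) :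
    Integrable (current F hF ψ) :=
  integrable_im_conj_mul ψ (fourierMul F hF ψ)

theorem integral_current (F : ℝ → ℝ) (hF : BddMeasurable F) (ψ : L2) :
    ∫ x, current F hF ψ x = 0 := by
  have h1 : (⟪ψ, fourierMul F hF ψ⟫).im = 0 := by
    have := inner_conj_symm (𝕜 := ℂ) ψ (fourierMul F hF ψ)
    rw [inner_fourierMul_left] at this
    exact Complex.conj_eq_iff_im.1 this
  unfold current
  rw [integral_im_conj_mul, h1, mul_zero]

/-- Both operators are symmetric, so with `z = ⟪ψ, G(Q) B ψ⟫` the form is `i (conj z - z) = 2 Im z`.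
-/
theorem inner_mulComm (F G : ℝ → ℝ) (hF : BddMeasurable F) (hG : BddMeasurable G) (ψ : L2) :
    ⟪ψ, mulComm F G hF hG ψ⟫ = ((∫ x, G x * current F hF ψ x : ℝ) : ℂ) := by
  set z := ⟪ψ, funQ G hG (fourierMul F hF ψ)⟫ with hz
  have h1 : ⟪ψ, fourierMul F hF (funQ G hG ψ)⟫ = conj z := by
    rw [← inner_fourierMul_left, hz, ← inner_funQ_left, inner_conj_symm]
  have hi : Integrable fun x => (G x : ℂ) * (conj (ψ x) * fourierMul F hF ψ x) := by
    obtain ⟨M, hM⟩ := hG.bounded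
    refine (integrable_conj_mul _ _).bdd_mul (c := M)
      (Complex.measurable_ofReal.comp hG.measurable).aestronglyMeasurable (.of_forall fun x => ?_)
    simpa using hM x
  have h2 := integral_im (𝕜 := ℂ) hi
  rw [← inner_funQ_right G hG, ← hz] at h2
  simp only [RCLike.im_to_complex, Complex.im_ofReal_mul] at h2
  rw [mulComm_apply, inner_smul_right, inner_sub_right, h1, ← hz]
  have : ∫ x, G x * current F hF ψ x
      = 2 * ∫ x, G x * (conj (ψ x) * fourierMul F hF ψ x).im := by
    rw [← integral_const_mul]
    congr 1 with x
    rw [current]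
    ring
  rw [this, h2]
  refine Complex.ext ?_ ?_ <;> simp
  ring

/-! ### Translation covariance -/

/-- Translation by `b` in `L²(ℝ)`. -/
def translate (b : ℝ) : L2 →ₗᵢ[ℂ] L2 :=
  Lp.compMeasurePreservingₗᵢ ℂ (fun x => x - b) (measurePreserving_sub_right volume b)

theorem translate_apply_ae (b : ℝ) (ψ : L2) : translate b ψ =ᵐ[volume] fun x => ψ (x - b) :=
  Lp.coeFn_compMeasurePreserving ψ (measurePreserving_sub_right volume b)

theorem continuous_translate (ψ : L2) : Continuous fun b => translate b ψ :=
  (continuous_const (y := ψ)).compMeasurePreservingLp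
    (g := fun b : ℝ => (⟨fun x => x - b, by fun_prop⟩ : C(ℝ, ℝ)))
    (ContinuousMap.continuous_of_continuous_uncurry _ (continuous_snd.sub continuous_fst))
    (fun b => measurePreserving_sub_right volume b) ENNReal.ofNat_ne_top

theorem translate_toL2 (b : ℝ) (ψ : 𝓢(ℝ, ℂ)) :
    translate b (toL2 ψ) = toL2 (ψ.compSubConstCLM ℂ b) := by
  refine Lp.ext ((translate_apply_ae b _).trans ?_)
  have h1 : (fun x => toL2 ψ (x - b)) =ᵐ[volume] ψ.compSubConstCLM ℂ b :=
    (measurePreserving_sub_right (volume : Measure ℝ) b).quasiMeasurePreserving.ae_eq (toL2_ae ψ)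
  exact h1.trans (toL2_ae (ψ.compSubConstCLM ℂ b)).symm

theorem fourierL2_toL2 (ψ : 𝓢(ℝ, ℂ)) : fourierL2 (toL2 ψ) = toL2 (𝓕 ψ) :=
  SchwartzMap.toLp_fourier_eq ψ

theorem denseRange_toL2 : DenseRange toL2 :=
  SchwartzMap.denseRange_toLpCLM ENNReal.ofNat_ne_top

theorem fourier_compSubConst (b : ℝ) (ψ : 𝓢(ℝ, ℂ)) (ξ : ℝ) :
    𝓕 (ψ.compSubConstCLM ℂ b) ξ = (Real.fourierChar (-(b * ξ)) : ℂ) * 𝓕 ψ ξ := by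
  have h := congrFun (VectorFourier.fourierIntegral_comp_add_right Real.fourierChar volume
    (innerₗ ℝ) ψ (-b)) ξ
  have e : (𝓕 (ψ.compSubConstCLM ℂ b)) ξ = VectorFourier.fourierIntegral Real.fourierChar volume
    (innerₗ ℝ) (ψ ∘ fun v => v + -b) ξ := rfl
  rw [e, h, Circle.smul_def, smul_eq_mul]
  congr 3
  simp [mul_comm]

/-- On the Fourier side a translation is multiplication by a unimodular character, which cancels
against its conjugate. -/
theorem inner_fourierMul_translate (F : ℝ → ℝ) (hF : BddMeasurable F) (b : ℝ) (χ ψ : 𝓢(ℝ, ℂ)) :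
    ⟪translate b (toL2 χ), fourierMul F hF (translate b (toL2 ψ))⟫
      = ⟪toL2 χ, fourierMul F hF (toL2 ψ)⟫ := by
  simp only [inner_fourierMul_right, inner_funQ_right, translate_toL2, fourierL2_toL2]
  refine integral_congr_ae ?_
  filter_upwards [toL2_ae (𝓕 χ), toL2_ae (𝓕 ψ), toL2_ae (𝓕 (χ.compSubConstCLM ℂ b)),
    toL2_ae (𝓕 (ψ.compSubConstCLM ℂ b))] with ξ h1 h2 h3 h4
  rw [h1, h2, h3, h4, fourier_compSubConst, fourier_compSubConst, map_mul]
  have : conj (Real.fourierChar (-(b * ξ)) : ℂ) * (Real.fourierChar (-(b * ξ)) : ℂ) = 1 := by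
    rw [Complex.conj_mul', Circle.norm_coe]
    simp
  linear_combination (F ξ : ℂ) * conj (𝓕 χ ξ) * 𝓕 ψ ξ * this

theorem fourierMul_translate (F : ℝ → ℝ) (hF : BddMeasurable F) (b : ℝ) (ψ : 𝓢(ℝ, ℂ)) :
    fourierMul F hF (translate b (toL2 ψ)) = translate b (fourierMul F hF (toL2 ψ)) := by
  refine denseRange_toL2.eq_of_inner_right (𝕜 := ℂ) fun χ => ?_
  have hχ : toL2 χ = translate b (toL2 (χ.compSubConstCLM ℂ (-b))) := by
    rw [translate_toL2, SchwartzMap.compSubConstCLM_comp, neg_add_cancel,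
      SchwartzMap.compSubConstCLM_zero]
    rfl
  rw [hχ, inner_fourierMul_translate, LinearIsometry.inner_map_map]

theorem current_translate_ae (F : ℝ → ℝ) (hF : BddMeasurable F) (b : ℝ) (ψ : 𝓢(ℝ, ℂ)) :
    current F hF (translate b (toL2 ψ)) =ᵐ[volume]
      fun x => current F hF (toL2 ψ) (x - b) := by
  filter_upwards [translate_apply_ae b (toL2 ψ),
    translate_apply_ae b (fourierMul F hF (toL2 ψ))] with x h1 h2
  rw [current, fourierMul_translate, h1, h2, current]

theorem inner_mulComm_translate (F G : ℝ → ℝ) (hF : BddMeasurable F) (hG : BddMeasurable G)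
    (ψ : 𝓢(ℝ, ℂ)) (b : ℝ) :
    ⟪translate b (toL2 ψ), mulComm F G hF hG (translate b (toL2 ψ))⟫
      = ((∫ x, G (x + b) * current F hF (toL2 ψ) x : ℝ) : ℂ) := by
  rw [inner_mulComm]
  congr 1
  refine Eq.trans ?_ (integral_sub_right_eq_self
    (fun x => G (x + b) * current F hF (toL2 ψ) x) b)
  refine integral_congr_ae ?_
  filter_upwards [current_translate_ae F hF b ψ] with x hx
  rw [hx, sub_add_cancel]

/-! ### Moments of the current -/

/-- The Schwartz function `x ↦ x ψ(x)`. -/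
def mulX (ψ : 𝓢(ℝ, ℂ)) : 𝓢(ℝ, ℂ) := SchwartzMap.smulLeftCLM ℂ (inner ℝ · (1 : ℝ)) ψ

theorem mulX_apply (ψ : 𝓢(ℝ, ℂ)) (x : ℝ) : mulX ψ x = x * ψ x := by
  have : (inner ℝ · (1 : ℝ)).HasTemperateGrowth := ((innerSL ℝ).flip (1 : ℝ)).hasTemperateGrowth
  rw [mulX, SchwartzMap.smulLeftCLM_apply_apply this]
  simp

/-- A real weight can be absorbed into the Schwartz factor `ψ`. The moments are then `L²` pairings,
and no decay of `Bψ` is needed, which a merely measurable symbol would not provide. -/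
theorem mul_current_ae (F : ℝ → ℝ) (hF : BddMeasurable F) {p : ℝ → ℝ} {χ ψ : 𝓢(ℝ, ℂ)}
    (h : ∀ x, χ x = p x * ψ x) :
    (fun x => p x * current F hF (toL2 ψ) x) =ᵐ[volume]
      fun x => 2 * (conj (toL2 χ x) * fourierMul F hF (toL2 ψ) x).im := by
  filter_upwards [toL2_ae ψ, toL2_ae χ] with x h1 h2
  rw [current, h1, h2, h, map_mul, Complex.conj_ofReal, mul_assoc, Complex.im_ofReal_mul]
  ring

theorem integrable_mul_current (F : ℝ → ℝ) (hF : BddMeasurable F) {p : ℝ → ℝ} {χ ψ : 𝓢(ℝ, ℂ)}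
    (h : ∀ x, χ x = p x * ψ x) : Integrable fun x => p x * current F hF (toL2 ψ) x :=
  (integrable_im_conj_mul (toL2 χ) (fourierMul F hF (toL2 ψ))).congr
    (mul_current_ae F hF h).symm

theorem integral_mulX_current (F : ℝ → ℝ) (hF : BddMeasurable F) (ψ : 𝓢(ℝ, ℂ)) :
    ∫ x, x * current F hF (toL2 ψ) x
      = 2 * (⟪toL2 (mulX ψ), fourierMul F hF (toL2 ψ)⟫).im := by
  rw [integral_congr_ae (mul_current_ae F hF (mulX_apply ψ)), integral_im_conj_mul]

theorem fourier_mulX (ψ : 𝓢(ℝ, ℂ)) (ξ : ℝ) :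
    𝓕 (mulX ψ) ξ = Complex.I / (2 * Real.pi) * deriv (𝓕 ψ : 𝓢(ℝ, ℂ)) ξ := by
  have h := congrArg (fun χ : 𝓢(ℝ, ℂ) => χ ξ) (SchwartzMap.lineDerivOp_fourier_eq ψ (1 : ℝ))
  have h1 : deriv (𝓕 ψ : 𝓢(ℝ, ℂ)) ξ = -(2 * Real.pi * Complex.I) * 𝓕 (mulX ψ) ξ := by
    have e : 𝓕 (-(2 * Real.pi * Complex.I) • mulX ψ) ξ
        = -(2 * Real.pi * Complex.I) * 𝓕 (mulX ψ) ξ := by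
      rw [FourierTransform.fourier_smul]
      rfl
    rw [← e]
    refine Eq.trans ?_ h
    rw [SchwartzMap.lineDerivOp_apply_eq_fderiv, fderiv_apply_one_eq_deriv]
  rw [h1]
  have hpi : (Real.pi : ℂ) ≠ 0 := by exact_mod_cast Real.pi_ne_zero
  field_simp
  linear_combination (𝓕 (mulX ψ) ξ) * Complex.I_sq

/-- The first moment of the current, expressed on the Fourier side for a state whose Fourier
transform is a real test function `φ`. -/
theorem exists_integral_mulX_current (F : ℝ → ℝ) (hF : BddMeasurable F) {φ : ℝ → ℝ}
    (hφ : ContDiff ℝ (⊤ : ℕ∞) φ) (hs : HasCompactSupport φ) :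
    ∃ ψ : 𝓢(ℝ, ℂ), ∫ x, x * current F hF (toL2 ψ) x
      = -Real.pi⁻¹ * ∫ ξ, F ξ * (φ ξ * deriv φ ξ) := by
  have hs' : HasCompactSupport fun x => (φ x : ℂ) := hs.comp_left (g := ((↑) : ℝ → ℂ)) rfl
  let Φ : 𝓢(ℝ, ℂ) := hs'.toSchwartzMap (Complex.ofRealCLM.contDiff.comp hφ)
  have hΦ : ∀ ξ, Φ ξ = φ ξ := fun ξ => rfl
  have hΦ' : ∀ ξ, deriv Φ ξ = deriv φ ξ := fun ξ =>
    ((hφ.differentiable (by simp)) ξ).hasDerivAt.ofReal_comp.deriv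
  refine ⟨𝓕⁻ Φ, ?_⟩
  have hF' : 𝓕 (𝓕⁻ Φ) = Φ := FourierTransform.fourier_fourierInv_eq Φ
  rw [integral_mulX_current, inner_fourierMul_right, fourierL2_toL2, fourierL2_toL2, hF',
    inner_funQ_right]
  -- Multiplication by `x` becomes `i/(2π)` times the derivative. As `φ` and `F` are real, the
  -- pairing is purely imaginary.
  have e : ∫ x, (F x : ℂ) * (conj (toL2 (𝓕 (mulX (𝓕⁻ Φ))) x) * toL2 Φ x)
      = -Complex.I / (2 * Real.pi) * ((∫ ξ, F ξ * (φ ξ * deriv φ ξ) : ℝ) : ℂ) := by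
    rw [← integral_complex_ofReal, ← integral_const_mul]
    refine integral_congr_ae ?_
    filter_upwards [toL2_ae Φ, toL2_ae (𝓕 (mulX (𝓕⁻ Φ)))] with ξ h1 h2
    rw [h1, h2, fourier_mulX, hF', hΦ, hΦ']
    simp only [map_mul, map_div₀, Complex.conj_I, Complex.conj_ofReal, map_ofNat]
    push_cast
    ring
  rw [e]
  have : -Complex.I / (2 * Real.pi) * ((∫ ξ, F ξ * (φ ξ * deriv φ ξ) : ℝ) : ℂ)
      = ((-(2 * Real.pi)⁻¹ * ∫ ξ, F ξ * (φ ξ * deriv φ ξ) : ℝ) : ℂ) * Complex.I := by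
    push_cast
    ring
  rw [this, Complex.im_ofReal_mul, Complex.I_im]
  field_simp

/-! ### From positivity of the commutator to monotonicity of one symbol -/

/-- Density extends the vanishing of the form to `L²`, and complex polarization then kills the
operator. -/
theorem mulComm_eq_zero (F G : ℝ → ℝ) (hF : BddMeasurable F) (hG : BddMeasurable G)
    (h : ∀ ψ : 𝓢(ℝ, ℂ), ⟪toL2 ψ, mulComm F G hF hG (toL2 ψ)⟫ = 0) :
    mulComm F G hF hG = 0 := by
  have h' : ∀ ψ : L2, ⟪ψ, mulComm F G hF hG ψ⟫ = 0 := fun ψ =>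
    denseRange_toL2.induction_on (p := fun ψ => ⟪ψ, mulComm F G hF hG ψ⟫ = 0) ψ
      (isClosed_eq (by fun_prop) continuous_const) h
  have h2 := (inner_map_self_eq_zero (mulComm F G hF hG : L2 →ₗ[ℂ] L2)).1 fun ψ => by
    rw [← inner_conj_symm]
    exact (congrArg conj (h' ψ)).trans (map_zero _)
  exact ContinuousLinearMap.coe_injective h2

theorem continuous_inner_mulComm_translate (F G : ℝ → ℝ) (hF : BddMeasurable F)
    (hG : BddMeasurable G) (ψ : L2) :
    Continuous fun b => (⟪translate b ψ, mulComm F G hF hG (translate b ψ)⟫).re := by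
  have := continuous_translate ψ
  fun_prop

/-- If `i [B, G(Q)]` is nonnegative and nonzero, then some limit point `c` of the mean asymmetry of
`G` is nonzero, and `c F` is non-decreasing, `F` being the symbol of the Fourier multiplier `B`. -/
theorem exists_aeMonotone_of_mulComm_nonneg (F G : ℝ → ℝ) (hF : BddMeasurable F)
    (hG : BddMeasurable G) (hpos : ∀ ψ, 0 ≤ (⟪ψ, mulComm F G hF hG ψ⟫).re)
    (hne : mulComm F G hF hG ≠ 0) :
    ∃ c : ℝ, c ≠ 0 ∧ AEMonotone (fun x => c * F x) ∧
      ∀ a : ℝ, AEMonotone (fun x => a * G x) → 0 ≤ a * c := by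
  obtain ⟨M, hM⟩ := hG.bounded
  obtain ⟨R, c, hR, hc⟩ := exists_tendsto_halfDiff hM
  have hΦ : ∀ (ψ : 𝓢(ℝ, ℂ)) (b : ℝ), 0 ≤ ∫ x, G (x + b) * current F hF (toL2 ψ) x := by
    intro ψ b
    have := hpos (translate b (toL2 ψ))
    rwa [inner_mulComm_translate, Complex.ofReal_re] at this
  have hlim : ∀ ψ : 𝓢(ℝ, ℂ), Tendsto (fun n => (R n)⁻¹ * ∫ u in -R n..0,
      windowIntegral (fun s => ∫ x, G (x + s) * current F hF (toL2 ψ) x) (R n) u)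
      atTop (𝓝 (c * ∫ x, x * current F hF (toL2 ψ) x)) := fun ψ =>
    tendsto_tent_average hG.measurable hM (integrable_current F hF _)
      (integrable_mul_current F hF (mulX_apply ψ))
      (integrable_mul_current F hF (χ := mulX (mulX ψ)) (p := fun x => x ^ 2)
        fun x => by rw [mulX_apply, mulX_apply]; push_cast; ring)
      (integral_current F hF _) hR hc
  refine ⟨c, ?_, ?_, ?_⟩
  · rintro rfl
    -- With `c = 0` the tent averages of the nonnegative correlation tend to `0` for every `ψ`, so
    -- its value at `0`, the quadratic form at `ψ`, vanishes.
    refine hne (mulComm_eq_zero F G hF hG fun ψ => ?_)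
    have hcont : Continuous fun b => ∫ x, G (x + b) * current F hF (toL2 ψ) x := by
      refine (continuous_inner_mulComm_translate F G hF hG (toL2 ψ)).congr fun b => ?_
      rw [inner_mulComm_translate, Complex.ofReal_re]
    have h0 := eq_zero_of_tent_average_tendsto_zero hcont (hΦ ψ) hR (by simpa using hlim ψ)
    rw [inner_mulComm]
    simpa using h0
  · obtain ⟨N, hN⟩ := hF.bounded
    refine aeMonotone_of_integral_nonpos (hF.measurable.const_mul c) (M := |c| * N)
      (fun x => by rw [abs_mul]; gcongr; exact hN x) fun φ hφ hs => ?_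
    obtain ⟨ψ, hψ⟩ := exists_integral_mulX_current F hF hφ hs
    -- A limit of nonnegative tent averages is nonnegative.
    have h1 : 0 ≤ c * ∫ x, x * current F hF (toL2 ψ) x := by
      refine ge_of_tendsto (hlim ψ) ?_
      filter_upwards [hR.eventually_ge_atTop 0] with n hn
      exact mul_nonneg (inv_nonneg.2 hn) (tent_average_nonneg (hΦ ψ) hn)
    rw [hψ] at h1
    simp_rw [mul_assoc]
    rw [integral_const_mul]
    have h2 : 0 ≤ Real.pi⁻¹ * -(c * ∫ x, F x * (φ x * deriv φ x)) := by
      linarith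
    have h3 := nonneg_of_mul_nonneg_right h2 (inv_pos.2 Real.pi_pos)
    linarith
  · rintro a ⟨H, hH, hHG⟩
    refine ge_of_tendsto (hc.const_mul a) ?_
    filter_upwards [hR.eventually_ge_atTop 0] with n hn
    have h1 := halfDiff_nonneg hH hn
    rw [halfDiff_congr_ae hHG, halfDiff_const_mul] at h1
    rw [mul_left_comm]
    exact mul_nonneg (inv_nonneg.2 hn) h1

/-! ### Exchange of the symbols under the Fourier transform -/

/-- The reflection `x ↦ -x` in `L²(ℝ)`. -/
def reflect : L2 →ₗᵢ[ℂ] L2 :=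
  Lp.compMeasurePreservingₗᵢ ℂ (fun x => -x) (Measure.measurePreserving_neg volume)

theorem reflect_apply_ae (ψ : L2) : reflect ψ =ᵐ[volume] fun x => ψ (-x) :=
  Lp.coeFn_compMeasurePreserving ψ (Measure.measurePreserving_neg volume)

theorem fourierL2_fourierL2 (ψ : L2) : fourierL2 (fourierL2 ψ) = reflect ψ := by
  refine denseRange_toL2.induction_on (p := fun ψ => fourierL2 (fourierL2 ψ) = reflect ψ) ψ
    (isClosed_eq (fourierL2.continuous.comp fourierL2.continuous) reflect.continuous) fun φ => ?_
  rw [fourierL2_toL2, fourierL2_toL2]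
  refine Lp.ext ?_
  have h1 : (fun x => toL2 φ (-x)) =ᵐ[volume] fun x => φ (-x) :=
    (Measure.measurePreserving_neg (volume : Measure ℝ)).quasiMeasurePreserving.ae_eq (toL2_ae φ)
  filter_upwards [toL2_ae (𝓕 (𝓕 φ)), reflect_apply_ae (toL2 φ), h1] with x h2 h3 h4
  rw [h2, h3, h4]
  have h5 : 𝓕⁻ (𝓕 φ) = φ := FourierTransform.fourierInv_fourier_eq φ
  have h6 := congrArg (fun χ : 𝓢(ℝ, ℂ) => χ (-x)) h5
  rw [SchwartzMap.fourierInv_apply_eq] at h6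
  rw [← h6]
  simp

theorem BddMeasurable.comp_neg {G : ℝ → ℝ} (hG : BddMeasurable G) :
    BddMeasurable fun x => G (-x) :=
  ⟨hG.measurable.comp measurable_neg, hG.bounded.imp fun _ hM x => hM (-x)⟩

theorem BddMeasurable.neg {G : ℝ → ℝ} (hG : BddMeasurable G) : BddMeasurable fun x => -G x :=
  ⟨hG.measurable.neg, hG.bounded.imp fun _ hM x => by simpa using hM x⟩

theorem funQ_neg (G : ℝ → ℝ) (hG : BddMeasurable G) (ψ : L2) :
    funQ (fun x => -G x) hG.neg ψ = -funQ G hG ψ := by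
  refine Lp.ext ?_
  filter_upwards [funQ_apply_ae _ hG.neg ψ, funQ_apply_ae G hG ψ,
    Lp.coeFn_neg (funQ G hG ψ)] with x h1 h2 h3
  rw [h1, h3, Pi.neg_apply, h2]
  push_cast
  ring

theorem reflect_funQ (G : ℝ → ℝ) (hG : BddMeasurable G) (ψ : L2) :
    reflect (funQ G hG ψ) = funQ (fun x => G (-x)) hG.comp_neg (reflect ψ) := by
  refine Lp.ext ?_
  have h1 : (fun x => funQ G hG ψ (-x)) =ᵐ[volume] fun x => (G (-x) : ℂ) * ψ (-x) :=
    (Measure.measurePreserving_neg (volume : Measure ℝ)).quasiMeasurePreserving.ae_eq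
      (funQ_apply_ae G hG ψ)
  filter_upwards [h1, reflect_apply_ae (funQ G hG ψ), reflect_apply_ae ψ,
    funQ_apply_ae _ hG.comp_neg (reflect ψ)] with x h1 h2 h3 h4
  rw [h2, h1, h4, h3]

/-- The reflection of the symbol appears because the square of the Fourier transform is `x ↦ -x`. -/
theorem fourierL2_funQ (G : ℝ → ℝ) (hG : BddMeasurable G) (ψ : L2) :
    fourierL2 (funQ G hG ψ) = fourierMul (fun x => G (-x)) hG.comp_neg (fourierL2 ψ) := by
  apply fourierL2.injective
  rw [fourierMul_apply, fourierL2.apply_symm_apply, fourierL2_fourierL2, fourierL2_fourierL2,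
    reflect_funQ]

theorem fourierL2_fourierMul (F : ℝ → ℝ) (hF : BddMeasurable F) (ψ : L2) :
    fourierL2 (fourierMul F hF ψ) = funQ F hF (fourierL2 ψ) := by
  rw [fourierMul_apply, fourierL2.apply_symm_apply]

/-- Conjugation by the Fourier transform exchanges the roles of the two symbols. -/
theorem fourierL2_mulComm (F G : ℝ → ℝ) (hF : BddMeasurable F) (hG : BddMeasurable G) (ψ : L2) :
    fourierL2 (mulComm F G hF hG ψ)
      = mulComm (fun x => -G (-x)) F hG.comp_neg.neg hF (fourierL2 ψ) := by
  have h : ∀ χ, fourierMul (fun x => -G (-x)) hG.comp_neg.neg χ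
      = -fourierMul (fun x => G (-x)) hG.comp_neg χ := fun χ => by
    rw [fourierMul_apply, fourierMul_apply, funQ_neg (fun x => G (-x)) hG.comp_neg, map_neg]
  rw [mulComm_apply, mulComm_apply, map_smul, map_sub, fourierL2_fourierMul, fourierL2_funQ,
    fourierL2_funQ, fourierL2_fourierMul, h, h, map_neg]
  congr 1
  abel

/-! ### Rescaling and the common direction of monotonicity -/

theorem AEMonotone.comp_const_mul {f : ℝ → ℝ} {a : ℝ} (ha : 0 < a)
    (h : AEMonotone fun x => f (a * x)) : AEMonotone f := by
  obtain ⟨H, hH, hHf⟩ := h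
  refine ⟨fun x => H (a⁻¹ * x), hH.comp fun x y hxy => by gcongr, ?_⟩
  have hq : Measure.QuasiMeasurePreserving (fun x : ℝ => a⁻¹ * x) :=
    Measure.quasiMeasurePreserving_smul volume (inv_pos.2 ha).ne'
  filter_upwards [hq.ae hHf] with x hx
  rw [hx, mul_inv_cancel_left₀ ha.ne']

theorem AEMonotone.neg_comp_neg {f : ℝ → ℝ} (h : AEMonotone fun x => -f (-x)) :
    AEMonotone f := by
  obtain ⟨H, hH, hHf⟩ := h
  refine ⟨fun x => -H (-x), fun x y hxy => neg_le_neg (hH (neg_le_neg hxy)), ?_⟩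
  filter_upwards [(Measure.measurePreserving_neg
    (volume : Measure ℝ)).quasiMeasurePreserving.ae hHf] with x hx
  simp [hx]

theorem exists_monotone_of_comm_isPositive (f g : ℝ → ℝ) (hf : BddMeasurable f) (hg : BddMeasurable g)
    (hpos : (comm f g hf hg).IsPositive) (hne : comm f g hf hg ≠ 0) :
    ∃ F G : ℝ → ℝ, F =ᵐ[volume] f ∧ G =ᵐ[volume] g ∧
      ((Monotone F ∧ Monotone G) ∨ (Antitone F ∧ Antitone G)) := by
  rw [comm_eq_mulComm] at hpos hne
  have hF := hf.comp_mul (2 * Real.pi)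
  have hpos1 : ∀ ψ : L2, 0 ≤ (⟪ψ, mulComm (fun x => f (2 * Real.pi * x)) g hF hg ψ⟫).re :=
    fun ψ => hpos.re_inner_nonneg_right ψ
  obtain ⟨c, hc, hcf, -⟩ := exists_aeMonotone_of_mulComm_nonneg _ g hF hg hpos1 hne
  -- The same result for the Fourier-conjugated operator: `d` is now a limit point of the mean
  -- asymmetry of `x ↦ f (2πx)`, so `hsign` can be applied with `a = c`.
  obtain ⟨d, hd, hdg, hsign⟩ := exists_aeMonotone_of_mulComm_nonneg (fun x => -g (-x)) _
    hg.comp_neg.neg hF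
    (fun ψ => by
      have h := hpos1 (fourierL2.symm ψ)
      rwa [← fourierL2.inner_map_map, fourierL2_mulComm, fourierL2.apply_symm_apply] at h)
    (fun h0 => hne (ContinuousLinearMap.ext fun ψ => fourierL2.injective (by
      rw [fourierL2_mulComm, h0]
      simp)))
  have hcd : 0 < c * d := (hsign c hcf).lt_of_ne (mul_ne_zero hc hd).symm
  have hcf' : AEMonotone fun x => c * f x :=
    AEMonotone.comp_const_mul (f := fun x => c * f x) Real.two_pi_pos hcf
  have hdg' : AEMonotone fun x => d * g x :=
    AEMonotone.neg_comp_neg (f := fun x => d * g x) (by simpa using hdg)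
  have hscale : ∀ {u : ℝ → ℝ} {a : ℝ}, AEMonotone (fun x => a * u x) → a ≠ 0 →
      ∃ U : ℝ → ℝ, U =ᵐ[volume] u ∧ (0 < a → Monotone U) ∧ (a < 0 → Antitone U) := by
    rintro u a ⟨H, hH, hHu⟩ ha
    refine ⟨fun x => a⁻¹ * H x, ?_, fun h => hH.const_mul (inv_pos.2 h).le,
      fun h => hH.const_mul_of_nonpos (inv_lt_zero.2 h).le⟩
    filter_upwards [hHu] with x hx
    rw [hx, inv_mul_cancel_left₀ ha]
  obtain ⟨F, hFf, hF1, hF2⟩ := hscale hcf' hc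
  obtain ⟨G, hGg, hG1, hG2⟩ := hscale hdg' hd
  refine ⟨F, G, hFf, hGg, ?_⟩
  rcases pos_and_pos_or_neg_and_neg_of_mul_pos hcd with ⟨h1, h2⟩ | ⟨h1, h2⟩
  · exact .inl ⟨hF1 h1, hG1 h2⟩
  · exact .inr ⟨hF2 h1, hG2 h2⟩

end PosComm
end

theorem theorem1p3 (f g : ℝ → ℝ) (hf : PosComm.BddMeasurable f) (hg : PosComm.BddMeasurable g)
    (hpos : (PosComm.comm f g hf hg).IsPositive) (hne : PosComm.comm f g hf hg ≠ 0) :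
    ∃ F G : ℝ → ℝ, F =ᵐ[volume] f ∧ G =ᵐ[volume] g ∧
      ((Monotone F ∧ Monotone G) ∨ (Antitone F ∧ Antitone G)) :=
  PosComm.exists_monotone_of_comm_isPositive f g hf hg hpos hne
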